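/- Let $\mathbb D\subset\mathbb C$ be the open unit disc with its hyperbolic distance $\rho(z,w)=\operatorname{artanh}\left|\frac{z-w}{1-\bar w z}\right|$. For a domain $D\subset\mathbb C^n$ and $w,z\in D$ let $$c_D(w,z)=\sup\{\rho(F(w),F(z)) : F:D\to\mathbb D \text{ holomorphic}\}$$ be the Carathéodory pseudodistance and $$l_D(w,z)=\inf\{\rho(0,t) : t\in\mathbb D,\ \exists f:\mathbb D\to D \text{ holomorphic},\ f(0)=w,\ f(t)=z\}$$ the Lempert function ($\inf\emptyset=\infty$). The domain $D$ is taut if every sequence of holomorphic maps $\mathbb D\to D$ has a subsequence that either converges locally uniformly to a holomorphic map $\mathbb D\to D$ or diverges compactly, i.e. for all compact $K\subset\mathbb D$ and $L\subset D$ its members eventually map $K$ into the complement of $L$. A Lempert domain is a taut domain $D$ with $c_D=l_D$ on $D\times D$. A domain is linearly convex if its complement is a union of complex affine hyperplanes. Theorem. Let $a,b>0$ with $|a-b|\le 1$, and put $$F_{a,b}(z_1,z_2)=\frac{az_1+bz_2-z_1z_2}{az_2+bz_1-1},\qquad D_{a,b}=\{z\in\mathbb D^2 : az_2+bz_1\ne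 1,\ |F_{a,b}(z)|<1\}.$$ Then $D_{a,b}$ is a Lempert domain (in particular it is open, nonempty and connected). If moreover $a,b,1$ satisfy the strict triangle inequality, i.e. $a<b+1$, $b<a+1$ and $1<a+b$, then $D_{a,b}$ is not linearly convex. -/

import Mathlib

open Set Filter Topology

noncomputable section

/-- The open unit disc in the complex plane. -/
def unitDisc : Set ℂ := Metric.ball 0 1

/-- The hyperbolic (Poincaré) distance of two points of the unit disc,
`artanh |(z - w) / (1 - conj w * z)|`. -/
def hypDist (z w : ℂ) : ℝ :=
  Real.artanh ‖(z - w) / (1 - (starRingEnd ℂ) w * z)‖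

section General

variable {E F : Type*} [NormedAddCommGroup E] [NormedSpace ℂ E]
  [NormedAddCommGroup F] [NormedSpace ℂ F]

/-- The holomorphic maps from `S` to `T` (for open `S`), given by functions on the ambient space
of which only the restriction to `S` matters. -/
def holMaps (S : Set E) (T : Set F) : Set (E → F) :=
  {f | DifferentiableOn ℂ f S ∧ MapsTo f S T}

/-- The Carathéodory pseudodistance of `D`: the supremum of `ρ (F w) (F z)` over all holomorphic
`F : D → 𝔻`, taken in `[0, ∞]`. -/
def caratheodoryDist (D : Set E) (w z : E) : ENNReal :=
  ⨆ F ∈ holMaps D unitDisc, ENNReal.ofReal (hypDist (F w) (F z))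

/-- The Lempert function of `D`: the infimum of `ρ 0 t` over all `t ∈ 𝔻` for which some
holomorphic `f : 𝔻 → D` has `f 0 = w` and `f t = z`, taken in `[0, ∞]`; it is `∞` if there is
no such `t`. -/
def lempertFunction (D : Set E) (w z : E) : ENNReal :=
  ⨅ t ∈ {t : ℂ | t ∈ unitDisc ∧ ∃ f ∈ holMaps unitDisc D, f 0 = w ∧ f t = z},
    ENNReal.ofReal (hypDist 0 t)

/-- `D` is taut: the holomorphic maps `𝔻 → D` form a normal family, that is, every sequence of
them has a subsequence that either converges locally uniformly on `𝔻` to a holomorphic map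
`𝔻 → D`, or diverges compactly (for all compact `K ⊆ 𝔻` and `L ⊆ D`, the image of `K` is
eventually disjoint from `L`). -/
def IsTaut (D : Set E) : Prop :=
  ∀ f : ℕ → ℂ → E, (∀ k, f k ∈ holMaps unitDisc D) →
    ∃ φ : ℕ → ℕ, StrictMono φ ∧
      ((∃ g ∈ holMaps unitDisc D,
          TendstoLocallyUniformlyOn (fun k => f (φ k)) g atTop unitDisc) ∨
        (∀ K ⊆ unitDisc, IsCompact K → ∀ L ⊆ D, IsCompact L →
          ∀ᶠ k in atTop, Disjoint (f (φ k) '' K) L))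

/-- A Lempert domain: a taut domain (nonempty connected open set) on which the Carathéodory
pseudodistance and the Lempert function coincide. -/
structure IsLempertDomain (D : Set E) : Prop where
  isOpen : IsOpen D
  isConnected : IsConnected D
  isTaut : IsTaut D
  caratheodory_eq_lempert : ∀ w ∈ D, ∀ z ∈ D, caratheodoryDist D w z = lempertFunction D w z

/-- `D` is linearly convex: its complement is a union of complex affine hyperplanes, that is,
through every point `w` outside `D` there is a complex affine hyperplane disjoint from `D`. -/
def IsLinearlyConvex (D : Set E) : Prop :=
  ∀ w ∉ D, ∃ ℓ : E →L[ℂ] ℂ, ℓ ≠ 0 ∧ ∀ z, ℓ z = ℓ w → z ∉ D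

end General

/-- The numerator of `F_{a,b}`. -/
def numF (a b : ℝ) (z : ℂ × ℂ) : ℂ := a * z.1 + b * z.2 - z.1 * z.2

/-- The denominator of `F_{a,b}`. -/
def denF (a b : ℝ) (z : ℂ × ℂ) : ℂ := a * z.2 + b * z.1 - 1

/-- The rational function `F_{a,b}` (meaningful where the denominator does not vanish). -/
def ratF (a b : ℝ) (z : ℂ × ℂ) : ℂ := numF a b z / denF a b z

/-- The set `D_{a,b}` of all points of the bidisc at which `F_{a,b}` is defined and has modulus
less than `1`. -/
def domainD (a b : ℝ) : Set (ℂ × ℂ) :=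
  {z | z.1 ∈ unitDisc ∧ z.2 ∈ unitDisc ∧ denF a b z ≠ 0 ∧ ‖ratF a b z‖ < 1}

/-- Three real numbers satisfy the (strict) triangle inequality: each is less than the sum of the
other two. -/
def TriangleIneq (x y t : ℝ) : Prop := x < y + t ∧ y < x + t ∧ t < x + y

end

/-!
Write `F` for `ratF a b`, and let `surf a b c` be the polynomial
`a z₁ + b z₂ + c z₃ - a z₂ z₃ - b z₁ z₃ - c z₁ z₂`. The map `z ↦ (z₁, z₂, F z)` identifies
`domainD a b` with the part of the surface `surf a b 1 = 0` in the tridisc: for `|a - b| ≤ 1` the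
denominator of `F` cannot vanish there (`sub_sub_ne_zero_of_surf`). The three coordinates play
symmetric roles.

*Lempert property.* By the Schwarz–Pick lemma it is enough to find, for two points `w`, `z` of the
domain, a holomorphic disc through both that is an isometry for one of the functions `z₁`, `z₂`,
`F` (`exists_geodesic_domainD`). The function to use is the one that moves `w` and `z` furthest
apart, say `z₁`.
* If `a + b ≤ 1`, the domain is the whole bidisc (`mem_domainD_of_add_le_one`), where such discs
  are well known.
* If `a + b ≥ 1`, there are unimodular `σ`, `τ`, the angles of a triangle with sides `a`, `b`, `1`,
  for which the line `{(σ, τ)} × ℂ` lies in the surface. Applying Möbius maps to the three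
  coordinates moves `w` to the origin and gives the equation the form
  `A x₁ + B x₂ + C x₃ = conj A x₂ x₃ + conj B x₁ x₃ + conj C x₁ x₂` (`surf_mobius`). A disc
  `λ ↦ (λ, λ g₂ λ, λ g₃ λ)` in this surface is determined by `g₂`. A Blaschke factor `g₂` can be
  prescribed at one interior point, so that the disc passes through the image of `z`, and
  at one boundary point, so that its first two coordinates meet `(σ, τ)`. The second condition
  makes a factor cancel in the formula for `g₃`, which thus has degree one again, and a degree one
  quotient of this shape is bounded by `1` on the disc as soon as it is bounded by `1` at one point
  (`exists_schur_pair`).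

*Connectedness* follows from the existence of these discs. *Tautness* is Montel's theorem for
`(z₁, z₂, F)`: by the maximum principle either a coordinate of the limit is unimodular, and then
the sequence diverges compactly, or the limit lies in the surface and the open tridisc.

*Linear convexity* fails at a boundary point `(x, x)` with `F = -1`: a line on which the first
order term of `F` vanishes has direction `(1, -1)`, and the second order term does not vanish
there, so `F` is an open map on each complex line through the point
(`exists_mem_domainD_line`).
-/

open scoped ComplexConjugate

/-! ### Möbius maps and the Schwarz–Pick lemma -/

theorem mem_unitDisc {z : ℂ} : z ∈ unitDisc ↔ ‖z‖ < 1 := by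
  simp [unitDisc]

theorem zero_mem_unitDisc : (0 : ℂ) ∈ unitDisc := by
  simp [unitDisc]

theorem isOpen_unitDisc : IsOpen unitDisc := Metric.isOpen_ball

theorem isPreconnected_unitDisc : IsPreconnected unitDisc :=
  (convex_ball (0 : ℂ) 1).isPreconnected

/-- The automorphism `x ↦ (x + w) / (1 + conj w * x)` of the unit disc; it carries `0` to `w`, and
its inverse is `mobius (-w)`. -/
noncomputable def mobius (w x : ℂ) : ℂ := (x + w) / (1 + conj w * x)

theorem one_add_conj_mul_ne_zero {w x : ℂ} (hw : ‖w‖ < 1) (hx : ‖x‖ ≤ 1) :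
    1 + conj w * x ≠ 0 := by
  intro h
  have h1 : conj w * x = -1 := by linear_combination h
  have h2 : ‖w‖ * ‖x‖ = 1 := by
    have := congrArg norm h1
    simpa using this
  nlinarith [norm_nonneg w, norm_nonneg x]

theorem norm_sq_one_add_sub_norm_sq_add (w x : ℂ) :
    ‖1 + conj w * x‖ ^ 2 - ‖x + w‖ ^ 2 = (1 - ‖w‖ ^ 2) * (1 - ‖x‖ ^ 2) := by
  simp only [← Complex.normSq_eq_norm_sq, Complex.normSq_apply]
  simp
  ring

theorem norm_mobius_lt_one {w x : ℂ} (hw : ‖w‖ < 1) (hx : ‖x‖ < 1) : ‖mobius w x‖ < 1 := by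
  have h0 := one_add_conj_mul_ne_zero hw hx.le
  rw [mobius, norm_div, div_lt_one (norm_pos_iff.mpr h0)]
  have h := norm_sq_one_add_sub_norm_sq_add w x
  have h1 : 0 < (1 - ‖w‖ ^ 2) * (1 - ‖x‖ ^ 2) := by
    apply mul_pos <;> nlinarith [norm_nonneg w, norm_nonneg x]
  exact lt_of_pow_lt_pow_left₀ 2 (norm_nonneg _) (by linarith)

theorem norm_mobius_of_norm_eq_one {w x : ℂ} (hw : ‖w‖ < 1) (hx : ‖x‖ = 1) :
    ‖mobius w x‖ = 1 := by
  have h0 := one_add_conj_mul_ne_zero hw hx.le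
  rw [mobius, norm_div, div_eq_one_iff_eq (norm_ne_zero_iff.mpr h0)]
  have h := norm_sq_one_add_sub_norm_sq_add w x
  rw [hx] at h
  exact (pow_left_inj₀ (norm_nonneg _) (norm_nonneg _) two_ne_zero).mp (by linarith)

theorem mobius_zero (w : ℂ) : mobius w 0 = w := by simp [mobius]

theorem one_sub_mul_conj_ne_zero {w : ℂ} (hw : ‖w‖ < 1) : 1 - w * conj w ≠ 0 := by
  have := one_add_conj_mul_ne_zero hw (x := -w) (by simpa using hw.le)
  intro h
  exact this (by linear_combination h)

theorem mobius_mobius_neg {w x : ℂ} (hw : ‖w‖ < 1) (hx : ‖x‖ ≤ 1) :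
    mobius w (mobius (-w) x) = x := by
  have h0 := one_add_conj_mul_ne_zero (w := -w) (by simpa using hw) hx
  have h1 := one_sub_mul_conj_ne_zero hw
  simp only [mobius, map_neg, neg_mul, ← sub_eq_add_neg] at h0 ⊢
  have h2 : 1 + conj w * ((x - w) / (1 - conj w * x)) = (1 - w * conj w) / (1 - conj w * x) := by
    field_simp
    ring
  have h3 : (x - w) / (1 - conj w * x) + w = x * (1 - w * conj w) / (1 - conj w * x) := by
    rw [div_add' _ _ _ h0]
    congr 1
    ring
  rw [h2, h3, div_div_div_cancel_right₀ h0, mul_div_cancel_right₀ _ h1]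

theorem differentiableOn_mobius_comp {w : ℂ} (hw : ‖w‖ < 1) {g : ℂ → ℂ} {S : Set ℂ}
    (hg : DifferentiableOn ℂ g S) (hg1 : ∀ x ∈ S, ‖g x‖ < 1) :
    DifferentiableOn ℂ (fun x => mobius w (g x)) S := by
  unfold mobius
  exact (hg.add_const _).div ((hg.const_mul _).const_add _)
    fun x hx => one_add_conj_mul_ne_zero hw (hg1 x hx).le

theorem hypDist_eq_artanh_mobius (w z : ℂ) : hypDist w z = Real.artanh ‖mobius (-w) z‖ := by
  have h1 : ‖w - z‖ = ‖z + -w‖ := by rw [norm_sub_rev, sub_eq_add_neg]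
  have h2 : ‖1 - conj z * w‖ = ‖1 + conj (-w) * z‖ := by
    rw [← Complex.norm_conj (1 - conj z * w)]
    congr 1
    simp
    ring
  rw [hypDist, mobius, norm_div, norm_div, h1, h2]

theorem hypDist_zero_left (t : ℂ) : hypDist 0 t = Real.artanh ‖t‖ := by
  simp [hypDist]

/-- The **Schwarz–Pick lemma**, with one of the two points at the centre of the disc. -/
theorem hypDist_map_le {g : ℂ → ℂ} (hg : g ∈ holMaps unitDisc unitDisc) {t : ℂ}
    (ht : t ∈ unitDisc) : hypDist (g 0) (g t) ≤ hypDist 0 t := by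
  have hlt : ∀ x ∈ unitDisc, ‖g x‖ < 1 := fun x hx => mem_unitDisc.mp (hg.2 hx)
  have h0 : ‖-g 0‖ < 1 := by simpa using hlt 0 zero_mem_unitDisc
  have hle : ‖mobius (-g 0) (g t)‖ ≤ ‖t‖ := by
    refine Complex.norm_le_norm_of_mapsTo_ball (R := 1)
      (f := fun x => mobius (-g 0) (g x)) (differentiableOn_mobius_comp h0 hg.1 hlt) ?_ ?_
      (mem_unitDisc.mp ht)
    · intro x hx
      simpa using (norm_mobius_lt_one h0 (hlt x hx)).le
    · simp [mobius]
  rw [hypDist_eq_artanh_mobius, hypDist_zero_left]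
  exact Real.artanh_le_artanh (by linarith [norm_nonneg (mobius (-g 0) (g t))])
    (mem_unitDisc.mp ht) hle

theorem caratheodoryDist_le_lempertFunction {E : Type*} [NormedAddCommGroup E] [NormedSpace ℂ E]
    (D : Set E) (w z : E) : caratheodoryDist D w z ≤ lempertFunction D w z := by
  refine iSup₂_le fun F hF => le_iInf₂ fun t ht => ?_
  obtain ⟨ht, f, hf, rfl, rfl⟩ := ht
  exact ENNReal.ofReal_le_ofReal
    (hypDist_map_le (g := F ∘ f) ⟨hF.1.comp hf.1 hf.2, hF.2.comp hf.2⟩ ht)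

/-- An analytic disc through `w` and `z` on which some bounded function `F` attains equality in the
Schwarz–Pick lemma shows that the two invariant functions agree at `(w, z)`. -/
theorem caratheodoryDist_eq_lempertFunction_of_disc {E : Type*} [NormedAddCommGroup E]
    [NormedSpace ℂ E] {D : Set E} {w z : E} {f : ℂ → E} (hf : f ∈ holMaps unitDisc D) {t : ℂ}
    (ht : t ∈ unitDisc) (hw : f 0 = w) (hz : f t = z) {F : E → ℂ} (hF : F ∈ holMaps D unitDisc)
    (hFt : ‖mobius (-F w) (F z)‖ = ‖t‖) :
    caratheodoryDist D w z = lempertFunction D w z := by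
  refine le_antisymm (caratheodoryDist_le_lempertFunction D w z) ?_
  calc lempertFunction D w z ≤ ENNReal.ofReal (hypDist 0 t) := iInf₂_le t ⟨ht, f, hf, hw, hz⟩
    _ = ENNReal.ofReal (hypDist (F w) (F z)) := by
      rw [hypDist_zero_left, hypDist_eq_artanh_mobius, hFt]
    _ ≤ caratheodoryDist D w z :=
      le_iSup₂ (f := fun F (_ : F ∈ holMaps D unitDisc) => ENNReal.ofReal (hypDist (F w) (F z)))
        F hF

/-! ### Blaschke factors subject to the normalized surface equation -/

theorem norm_sq_conj_add_sub_norm_sq_add (p q x : ℂ) :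
    ‖conj q + conj p * x‖ ^ 2 - ‖p + q * x‖ ^ 2 = (‖q‖ ^ 2 - ‖p‖ ^ 2) * (1 - ‖x‖ ^ 2) := by
  simp only [← Complex.normSq_eq_norm_sq, Complex.normSq_apply]
  simp
  ring

theorem add_mul_ne_zero_of_norm_le {p q x : ℂ} (hp : p ≠ 0) (hqp : ‖q‖ ≤ ‖p‖) (hx : ‖x‖ < 1) :
    p + q * x ≠ 0 := by
  intro h
  have h1 : ‖p‖ = ‖q‖ * ‖x‖ := by
    rw [← norm_mul, ← norm_neg (q * x)]
    congr 1
    linear_combination h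
  have h2 := norm_pos_iff.mpr hp
  have h3 : ‖q‖ * ‖x‖ ≤ ‖p‖ * ‖x‖ := by gcongr
  nlinarith

theorem norm_conj_add_div_add_le_one {p q x : ℂ} (hqp : ‖q‖ ≤ ‖p‖)
    (hx : ‖x‖ < 1) : ‖(conj q + conj p * x) / (p + q * x)‖ ≤ 1 := by
  rw [norm_div]
  refine div_le_one_of_le₀ ?_ (norm_nonneg _)
  have h := norm_sq_conj_add_sub_norm_sq_add p q x
  have h1 : 0 ≤ (‖p‖ ^ 2 - ‖q‖ ^ 2) * (1 - ‖x‖ ^ 2) := by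
    apply mul_nonneg <;> nlinarith [norm_nonneg p, norm_nonneg q, norm_nonneg x]
  exact le_of_sq_le_sq (by linarith) (norm_nonneg _)

theorem norm_le_of_norm_conj_add_le {p q x : ℂ} (hx : ‖x‖ < 1)
    (h : ‖conj q + conj p * x‖ ≤ ‖p + q * x‖) : ‖q‖ ≤ ‖p‖ := by
  have h0 := norm_sq_conj_add_sub_norm_sq_add p q x
  have h1 : ‖conj q + conj p * x‖ ^ 2 ≤ ‖p + q * x‖ ^ 2 := by gcongr
  have h2 : 0 < 1 - ‖x‖ ^ 2 := by nlinarith [norm_nonneg x]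
  have h3 : ‖q‖ ^ 2 - ‖p‖ ^ 2 ≤ 0 := by
    by_contra hcon
    push Not at hcon
    have := mul_pos hcon h2
    linarith
  exact le_of_sq_le_sq (by linarith) (norm_nonneg _)

/-- Interpolation by a Blaschke factor `(conj q + conj p * x) / (p + q * x)` at an interior point
`x` (value `η`) and a boundary point `σ` (value `σ / κ ^ 2`), up to common zeros of numerator and
denominator. At `σ` numerator and denominator always have equal modulus, so the second condition
is one real linear equation, and the two together are three real linear equations for the four
real coordinates of `(p, q)`. -/
theorem exists_blaschke_coeffs (x η σ κ : ℂ) (hσ : ‖σ‖ = 1) (hκ : ‖κ‖ = 1) :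
    ∃ p q : ℂ, (p ≠ 0 ∨ q ≠ 0) ∧ conj q + conj p * x = η * (p + q * x) ∧
      σ * (conj q + conj p * σ) * κ ^ 2 = σ ^ 2 * (p + q * σ) := by
  let L : ℂ × ℂ →ₗ[ℝ] ℂ × ℝ :=
    { toFun := fun v => (conj v.2 + conj v.1 * x - η * (v.1 + v.2 * x),
        ((v.1 + v.2 * σ) * conj κ).im)
      map_add' := by
        intro u v
        ext1
        · simp
          ring
        · simp
          ring
      map_smul' := by
        intro r v
        ext1
        · simp
          ring
        · simp
          ring }
  have hker : L.ker ≠ ⊥ := by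
    apply LinearMap.ker_ne_bot_of_finrank_lt
    simp
  obtain ⟨⟨p, q⟩, hpq, hne⟩ := (Submodule.ne_bot_iff _).mp hker
  have hL : L (p, q) = 0 := hpq
  have h1 : conj q + conj p * x - η * (p + q * x) = 0 := congrArg Prod.fst hL
  have h2 : ((p + q * σ) * conj κ).im = 0 := congrArg Prod.snd hL
  refine ⟨p, q, ?_, by linear_combination h1, ?_⟩
  · by_contra! h
    exact hne (by ext1 <;> simp [h.1, h.2])
  · have h3 := Complex.conj_eq_iff_im.mpr h2
    simp only [map_mul, map_add, Complex.conj_conj] at h3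
    have hσ' : σ * conj σ = 1 := by rw [Complex.mul_conj']; simp [hσ]
    have hκ' : κ * conj κ = 1 := by rw [Complex.mul_conj']; simp [hκ]
    linear_combination σ ^ 2 * κ * h3 - conj q * κ ^ 2 * σ * hσ' + σ ^ 2 * (p + q * σ) * hκ'

/-- A point `(x₁, x₂, x₃)` of the surface in the tridisc given by the normalized equation `hx`, with
dominant first coordinate, lies on a disc `x ↦ (x, x * g₂ x, x * g₃ x)` in this surface. The
hypothesis `hC` says that the line `{(σ, τ)} × ℂ` lies in the surface. -/
theorem exists_schur_pair {A B C σ τ x₁ x₂ x₃ : ℂ} (hσ : ‖σ‖ = 1) (hτ : ‖τ‖ = 1)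
    (hC : C = conj A * τ + conj B * σ)
    (hx : A * x₁ + B * x₂ + C * x₃ = conj A * x₂ * x₃ + conj B * x₁ * x₃ + conj C * x₁ * x₂)
    (h1 : x₁ ≠ 0) (h1' : ‖x₁‖ < 1) (h2 : ‖x₂‖ ≤ ‖x₁‖) (h3 : ‖x₃‖ ≤ ‖x₁‖)
    (hne : C - conj A * x₂ - conj B * x₁ ≠ 0) :
    ∃ g₂ g₃ : ℂ → ℂ, DifferentiableOn ℂ g₂ unitDisc ∧ DifferentiableOn ℂ g₃ unitDisc ∧
      (∀ x ∈ unitDisc, ‖g₂ x‖ ≤ 1) ∧ (∀ x ∈ unitDisc, ‖g₃ x‖ ≤ 1) ∧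
      x₁ * g₂ x₁ = x₂ ∧ x₁ * g₃ x₁ = x₃ ∧
      ∀ x ∈ unitDisc, A + B * g₂ x + C * g₃ x =
        conj A * x * g₂ x * g₃ x + conj B * x * g₃ x + conj C * x * g₂ x := by
  have hσ' : σ * conj σ = 1 := by rw [Complex.mul_conj']; simp [hσ]
  have hσ0 : σ ≠ 0 := by rw [← norm_ne_zero_iff, hσ]; norm_num
  have hτ0 : τ ≠ 0 := by rw [← norm_ne_zero_iff, hτ]; norm_num
  obtain ⟨κ, hκ⟩ := IsAlgClosed.exists_pow_nat_eq (σ ^ 2 / τ) (n := 2) (by norm_num)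
  have hκ1 : ‖κ‖ = 1 := by
    have := congrArg norm hκ
    simp only [norm_pow, norm_div, hσ, hτ] at this
    exact (pow_eq_one_iff_of_nonneg (norm_nonneg κ) two_ne_zero).mp (by simpa using this)
  obtain ⟨η₂, rfl⟩ : ∃ η, x₂ = x₁ * η := ⟨x₂ / x₁, by field_simp⟩
  obtain ⟨η₃, rfl⟩ : ∃ η, x₃ = x₁ * η := ⟨x₃ / x₁, by field_simp⟩
  have hx1 : 0 < ‖x₁‖ := norm_pos_iff.mpr h1
  have hη₂ : ‖η₂‖ ≤ 1 := by
    rw [norm_mul] at h2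
    exact le_of_mul_le_mul_left (by linarith) hx1
  have hη₃ : ‖η₃‖ ≤ 1 := by
    rw [norm_mul] at h3
    exact le_of_mul_le_mul_left (by linarith) hx1
  have hx' : A + B * η₂ + C * η₃ =
      conj A * x₁ * η₂ * η₃ + conj B * x₁ * η₃ + conj C * x₁ * η₂ :=
    mul_left_cancel₀ h1 (by linear_combination hx)
  obtain ⟨p, q, hpq, hP, hPσ⟩ := exists_blaschke_coeffs x₁ η₂ σ κ hσ hκ1
  have hPτ : σ * (conj q + conj p * σ) = τ * (p + q * σ) := by
    rw [hκ] at hPσ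
    field_simp at hPσ
    linear_combination hPσ
  have hqp : ‖q‖ ≤ ‖p‖ := by
    refine norm_le_of_norm_conj_add_le h1' ?_
    rw [hP, norm_mul]
    exact mul_le_of_le_one_left (norm_nonneg _) hη₂
  have hp : p ≠ 0 := by
    rintro rfl
    have : q = 0 := by simpa using hqp
    simp [this] at hpq
  set r : ℂ := -conj σ * (C * p) with hr
  set s : ℂ := -(conj B * q + conj A * conj p) with hs
  -- The boundary condition at `σ` makes `x - σ` a common factor of the numerator and the
  -- denominator of `g₃`, so that `g₃` also has degree at most one.
  have hmid : C * q - conj B * p - conj A * conj q = r - s * σ := by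
    have : (C * q - conj B * p - conj A * conj q) * σ = (r - s * σ) * σ := by
      rw [hr, hs, hC]
      linear_combination -conj A * hPτ + (conj A * τ + conj B * σ) * p * hσ'
    exact mul_right_cancel₀ hσ0 this
  have hmid' : conj C * conj q - B * conj p - A * q = conj r - conj s * conj σ := by
    have := congrArg conj hmid
    simpa using this
  have hr' : conj r = -σ * (conj C * conj p) := by simp [hr]
  have hs' : conj s = -(B * conj q + A * p) := by simp [hs]
  have hR : ∀ x, (C - conj B * x) * (p + q * x) - conj A * x * (conj q + conj p * x) =
      (x - σ) * (r + s * x) := by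
    intro x
    linear_combination x * hmid + σ * hr - x ^ 2 * hs - C * p * hσ'
  have hN : ∀ x, (conj C * x - B) * (conj q + conj p * x) - A * (p + q * x) =
      -conj σ * ((x - σ) * (conj s + conj r * x)) := by
    intro x
    linear_combination x * hmid' - x * conj r * hσ' - hs' - conj s * hσ' +
      x ^ 2 * conj σ * hr' - x ^ 2 * conj C * conj p * hσ'
  have hQ : ∀ x : ℂ, ‖x‖ < 1 → p + q * x ≠ 0 := fun x hx => add_mul_ne_zero_of_norm_le hp hqp hx
  have hxσ : ∀ x : ℂ, ‖x‖ < 1 → x - σ ≠ 0 := by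
    intro x hx h
    rw [sub_eq_zero.mp h] at hx
    linarith
  have hrs1 : r + s * x₁ ≠ 0 := by
    intro h
    have h4 := hR x₁
    rw [h, hP, mul_zero] at h4
    exact mul_ne_zero hne (hQ x₁ h1') (by linear_combination h4)
  have hval : η₃ * (r + s * x₁) = -conj σ * (conj s + conj r * x₁) := by
    have h4 := hR x₁
    have h5 := hN x₁
    rw [hP] at h4 h5
    refine mul_left_cancel₀ (hxσ x₁ h1') ?_
    linear_combination -η₃ * h4 + h5 + (p + q * x₁) * hx'
  have hsr : ‖s‖ ≤ ‖r‖ := by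
    refine norm_le_of_norm_conj_add_le h1' ?_
    have h4 := congrArg norm hval
    simp only [norm_mul, norm_neg, Complex.norm_conj, hσ, one_mul] at h4
    rw [← h4]
    exact mul_le_of_le_one_left (norm_nonneg _) hη₃
  have hr0 : r ≠ 0 := by
    intro h
    have : s = 0 := by simpa [h] using hsr
    exact hrs1 (by simp [h, this])
  have hD : ∀ x : ℂ, ‖x‖ < 1 → r + s * x ≠ 0 := fun x hx => add_mul_ne_zero_of_norm_le hr0 hsr hx
  refine ⟨fun x => (conj q + conj p * x) / (p + q * x),
    fun x => -conj σ * ((conj s + conj r * x) / (r + s * x)), ?_, ?_, ?_, ?_, ?_, ?_, ?_⟩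
  · exact DifferentiableOn.div (by fun_prop) (by fun_prop) fun x hx => hQ x (mem_unitDisc.mp hx)
  · exact (DifferentiableOn.div (by fun_prop) (by fun_prop)
      fun x hx => hD x (mem_unitDisc.mp hx)).const_mul _
  · exact fun x hx => norm_conj_add_div_add_le_one hqp (mem_unitDisc.mp hx)
  · intro x hx
    rw [norm_mul, norm_neg, Complex.norm_conj, hσ, one_mul]
    exact norm_conj_add_div_add_le_one hsr (mem_unitDisc.mp hx)
  · simp only
    rw [hP, mul_div_cancel_right₀ _ (hQ x₁ h1')]
  · simp only
    rw [← mul_div_assoc, ← hval, mul_div_cancel_right₀ _ hrs1]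
  · intro x hx
    have hQx := hQ x (mem_unitDisc.mp hx)
    have hDx := hD x (mem_unitDisc.mp hx)
    have hRx := hR x
    have hNx := hN x
    have hG₂ := div_mul_cancel₀ (conj q + conj p * x) hQx
    have hG₃ : -conj σ * ((conj s + conj r * x) / (r + s * x)) * (r + s * x) =
        -conj σ * (conj s + conj r * x) := by
      rw [mul_assoc, div_mul_cancel₀ _ hDx]
    set G₂ := (conj q + conj p * x) / (p + q * x)
    set G₃ := -conj σ * ((conj s + conj r * x) / (r + s * x))
    refine mul_left_cancel₀ hQx ?_
    linear_combination G₃ * hRx - (G₃ * conj A * x + conj C * x - B) * hG₂ - hNx + (x - σ) * hG₃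

/-! ### The surface in the tridisc -/

/-- The defining polynomial of the surface `{surf a b c = 0}` in the tridisc, of which `domainD a b`
(for `c = 1`) is the projection to the first two coordinates. It is invariant under simultaneous
permutations of the parameters and of the variables. -/
def surf (a b c : ℝ) (z₁ z₂ z₃ : ℂ) : ℂ :=
  a * z₁ + b * z₂ + c * z₃ - a * z₂ * z₃ - b * z₁ * z₃ - c * z₁ * z₂

/-- The first of the linear coefficients of `surf a b c` in the coordinates
`x_j = mobius (-w_j) z_j`; the other two arise by permuting the arguments. -/
noncomputable def surfCoeff (a b c : ℝ) (w₁ w₂ w₃ : ℂ) : ℂ :=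
  a + b * w₂ * conj w₁ + c * w₃ * conj w₁ - a * conj w₁ * w₂ * w₃ - b * w₃ - c * w₂

theorem mobius_mul_cancel {w x : ℂ} (h : 1 + conj w * x ≠ 0) :
    mobius w x * (1 + conj w * x) = x + w :=
  div_mul_cancel₀ _ h

/-- In the coordinates `x_j = mobius (-w_j) z_j` centred at a point `w` of the surface, the equation
keeps its shape, with complex coefficients. -/
theorem surf_mobius (a b c : ℝ) {w₁ w₂ w₃ x₁ x₂ x₃ : ℂ} (h₁ : 1 + conj w₁ * x₁ ≠ 0)
    (h₂ : 1 + conj w₂ * x₂ ≠ 0) (h₃ : 1 + conj w₃ * x₃ ≠ 0) (hw : surf a b c w₁ w₂ w₃ = 0) :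
    (1 + conj w₁ * x₁) * (1 + conj w₂ * x₂) * (1 + conj w₃ * x₃) *
        surf a b c (mobius w₁ x₁) (mobius w₂ x₂) (mobius w₃ x₃) =
      surfCoeff a b c w₁ w₂ w₃ * x₁ + surfCoeff b a c w₂ w₁ w₃ * x₂ +
        surfCoeff c a b w₃ w₁ w₂ * x₃ - (conj (surfCoeff a b c w₁ w₂ w₃) * x₂ * x₃ +
        conj (surfCoeff b a c w₂ w₁ w₃) * x₁ * x₃ + conj (surfCoeff c a b w₃ w₁ w₂) * x₁ * x₂) := by
  have m₁ := mobius_mul_cancel h₁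
  have m₂ := mobius_mul_cancel h₂
  have m₃ := mobius_mul_cancel h₃
  have hw' := congrArg conj hw
  simp only [surf, surfCoeff, map_add, map_sub, map_mul, map_zero, Complex.conj_ofReal,
    Complex.conj_conj] at hw hw' ⊢
  generalize mobius w₁ x₁ = z₁ at *
  generalize mobius w₂ x₂ = z₂ at *
  generalize mobius w₃ x₃ = z₃ at *
  generalize conj w₁ = v₁ at *
  generalize conj w₂ = v₂ at *
  generalize conj w₃ = v₃ at *
  linear_combination hw - x₁ * x₂ * x₃ * hw' +
    a * (1 + v₂ * x₂) * (1 + v₃ * x₃) * m₁ + b * (1 + v₁ * x₁) * (1 + v₃ * x₃) * m₂ +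
    c * (1 + v₁ * x₁) * (1 + v₂ * x₂) * m₃ -
    a * (1 + v₁ * x₁) * (z₃ * (1 + v₃ * x₃) * m₂ + (x₂ + w₂) * m₃) -
    b * (1 + v₂ * x₂) * (z₃ * (1 + v₃ * x₃) * m₁ + (x₁ + w₁) * m₃) -
    c * (1 + v₃ * x₃) * (z₂ * (1 + v₂ * x₂) * m₁ + (x₁ + w₁) * m₂)

/-- The coefficient of `x₃` in `surf_mobius`. -/
theorem surf_mobius_coeff (a b c : ℝ) {w₁ w₂ w₃ x₁ x₂ : ℂ} (h₁ : 1 + conj w₁ * x₁ ≠ 0)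
    (h₂ : 1 + conj w₂ * x₂ ≠ 0) (hw : surf a b c w₁ w₂ w₃ = 0) :
    (1 + conj w₁ * x₁) * (1 + conj w₂ * x₂) *
        ((c - a * mobius w₂ x₂ - b * mobius w₁ x₁) + conj w₃ * (a * mobius w₁ x₁ +
          b * mobius w₂ x₂ - c * mobius w₁ x₁ * mobius w₂ x₂)) =
      surfCoeff c a b w₃ w₁ w₂ - conj (surfCoeff a b c w₁ w₂ w₃) * x₂ -
        conj (surfCoeff b a c w₂ w₁ w₃) * x₁ := by
  have m₁ := mobius_mul_cancel h₁
  have m₂ := mobius_mul_cancel h₂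
  have hw' := congrArg conj hw
  simp only [surf, surfCoeff, map_add, map_sub, map_mul, map_zero, Complex.conj_ofReal,
    Complex.conj_conj] at hw hw' ⊢
  generalize mobius w₁ x₁ = z₁ at *
  generalize mobius w₂ x₂ = z₂ at *
  generalize conj w₁ = v₁ at *
  generalize conj w₂ = v₂ at *
  generalize conj w₃ = v₃ at *
  linear_combination - x₁ * x₂ * hw' - a * (1 + v₁ * x₁) * m₂ - b * (1 + v₂ * x₂) * m₁ +
    v₃ * (a * (1 + v₂ * x₂) * m₁ + b * (1 + v₁ * x₁) * m₂ -
      c * (z₂ * (1 + v₂ * x₂) * m₁ + (x₁ + w₁) * m₂))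

/-- The roots of `m * (z ^ 2 + 1) = k * z` are unimodular if `k` and `m` are real and
`|k| ≤ 2 * m`. -/
theorem one_le_norm_of_self_reciprocal {m k : ℝ} (hm : 0 < m) (hk : |k| ≤ 2 * m) {z : ℂ}
    (h : (m : ℂ) * (z ^ 2 + 1) = k * z) : 1 ≤ ‖z‖ := by
  have hre := congrArg Complex.re h
  have him := congrArg Complex.im h
  simp [pow_two] at hre him
  have hsq : ‖z‖ ^ 2 = z.re ^ 2 + z.im ^ 2 := by
    rw [← Complex.normSq_eq_norm_sq, Complex.normSq_apply]; ring
  suffices 1 ≤ ‖z‖ ^ 2 by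
    by_contra! hcon
    nlinarith [norm_nonneg z]
  rw [hsq]
  by_cases hy : z.im = 0
  · rw [hy] at hre ⊢
    have h1 : k * z.re ≤ 2 * m * |z.re| := by
      calc k * z.re ≤ |k * z.re| := le_abs_self _
        _ = |k| * |z.re| := abs_mul _ _
        _ ≤ 2 * m * |z.re| := by gcongr
    have h2 : m * (1 - |z.re|) ^ 2 ≤ 0 := by
      have := sq_abs z.re
      nlinarith
    have h3 : (1 - |z.re|) ^ 2 ≤ 0 := by
      by_contra! hcon
      nlinarith
    have h4 : |z.re| = 1 := by nlinarith
    have := sq_abs z.re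
    rw [h4] at this
    nlinarith
  · have h1 : k = 2 * m * z.re := mul_right_cancel₀ hy (by linear_combination -him)
    rw [h1] at hre
    have h2 : m * (z.re ^ 2 + z.im ^ 2) = m * 1 := by linear_combination -hre
    exact (mul_left_cancel₀ hm.ne' h2).ge

/-- The surface is a graph over the first two coordinates: where it meets the tridisc, the
coefficient of the third variable does not vanish. -/
theorem sub_sub_ne_zero_of_surf {a b c : ℝ} (ha : 0 < a) (hb : 0 < b) (hc : 0 < c)
    (hab : |a - b| ≤ c) {z₁ z₂ z₃ : ℂ} (h₁ : ‖z₁‖ < 1) (h₂ : ‖z₂‖ < 1)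
    (hz : surf a b c z₁ z₂ z₃ = 0) : (c - a * z₂ - b * z₁ : ℂ) ≠ 0 := by
  intro h
  rw [abs_le] at hab
  rcases lt_or_ge (a + b) c with hlt | hle
  · have h3 : (c : ℂ) = a * z₂ + b * z₁ := by linear_combination h
    have h4 := congrArg norm h3
    have h5 := norm_add_le (a * z₂) (b * z₁)
    rw [← h4] at h5
    simp only [norm_mul, Complex.norm_real, Real.norm_eq_abs, abs_of_pos ha, abs_of_pos hb,
      abs_of_pos hc] at h5
    nlinarith
  · refine absurd h₂ (not_lt.mpr (one_le_norm_of_self_reciprocal (m := a * c)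
      (k := a ^ 2 + c ^ 2 - b ^ 2) (by positivity) ?_ ?_))
    · rw [abs_le]
      constructor <;> nlinarith
    · unfold surf at hz
      push_cast
      linear_combination b * hz + (a - c * z₂ - b * z₃) * h

/-- The angles of a triangle with sides `a`, `b`, `c`. The lines `{(σ, τ)} × ℂ` and
`{(conj σ, conj τ)} × ℂ` lie in the surface `surf a b c = 0`. -/
theorem exists_unimodular_of_triangle {a b c : ℝ} (ha : 0 < a) (hb : 0 < b) (hc : 0 < c)
    (h1 : a ≤ b + c) (h2 : b ≤ a + c) (h3 : c ≤ a + b) :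
    ∃ σ τ : ℂ, ‖σ‖ = 1 ∧ ‖τ‖ = 1 ∧ (c : ℂ) = a * τ + b * σ := by
  obtain ⟨x, hx⟩ : ∃ x : ℝ, 2 * b * c * x = b ^ 2 + c ^ 2 - a ^ 2 :=
    ⟨(b ^ 2 + c ^ 2 - a ^ 2) / (2 * b * c), by field_simp⟩
  have hbc : 0 < b * c := by positivity
  have hx1 : -1 ≤ x := by
    by_contra! h
    nlinarith
  have hx2 : x ≤ 1 := by
    by_contra! h
    nlinarith
  have hy : √(1 - x ^ 2) ^ 2 = 1 - x ^ 2 := Real.sq_sqrt (by nlinarith)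
  set y := √(1 - x ^ 2)
  have key : ∀ z : ℂ, z.re ^ 2 + z.im ^ 2 = 1 → ‖z‖ = 1 := by
    intro z hz
    refine (pow_eq_one_iff_of_nonneg (norm_nonneg z) two_ne_zero).mp ?_
    rw [← Complex.normSq_eq_norm_sq, Complex.normSq_apply]
    linarith
  refine ⟨⟨x, y⟩, ⟨(c - b * x) / a, -(b * y) / a⟩, key _ ?_, key _ ?_, ?_⟩
  · simp only
    linarith
  · simp only
    field_simp
    linear_combination b ^ 2 * hy - hx
  · apply Complex.ext
    · simp
      field_simp
      ring
    · simp
      field_simp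
      ring

/-! ### Geodesic discs in the surface -/

theorem mobius_neg_eq_zero {w z : ℂ} (hw : ‖w‖ < 1) (hz : ‖z‖ < 1) (h : mobius (-w) z = 0) :
    z = w := by
  rw [← mobius_mobius_neg hw hz.le, h, mobius_zero]

/-- If the first coordinate realizes the largest of the three hyperbolic distances between two
points of the surface, then some holomorphic disc in the surface, passing through both points, is
an isometry for the hyperbolic distance in the first coordinate. -/
theorem exists_disc_of_surf {a b c : ℝ} (ha : 0 < a) (hb : 0 < b) (hc : 0 < c)
    (h1 : a ≤ b + c) (h2 : b ≤ a + c) (h3 : c ≤ a + b) {w₁ w₂ w₃ z₁ z₂ z₃ : ℂ}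
    (hw₁ : ‖w₁‖ < 1) (hw₂ : ‖w₂‖ < 1) (hw₃ : ‖w₃‖ < 1)
    (hz₁ : ‖z₁‖ < 1) (hz₂ : ‖z₂‖ < 1) (hz₃ : ‖z₃‖ < 1)
    (hw : surf a b c w₁ w₂ w₃ = 0) (hz : surf a b c z₁ z₂ z₃ = 0)
    (h₂₁ : ‖mobius (-w₂) z₂‖ ≤ ‖mobius (-w₁) z₁‖) (h₃₁ : ‖mobius (-w₃) z₃‖ ≤ ‖mobius (-w₁) z₁‖) :
    ∃ (t : ℂ) (f₁ f₂ f₃ : ℂ → ℂ), t ∈ unitDisc ∧ ‖mobius (-w₁) z₁‖ = ‖t‖ ∧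
      f₁ ∈ holMaps unitDisc unitDisc ∧ f₂ ∈ holMaps unitDisc unitDisc ∧
      f₃ ∈ holMaps unitDisc unitDisc ∧ (∀ x ∈ unitDisc, surf a b c (f₁ x) (f₂ x) (f₃ x) = 0) ∧
      (f₁ 0 = w₁ ∧ f₂ 0 = w₂ ∧ f₃ 0 = w₃) ∧ (f₁ t = z₁ ∧ f₂ t = z₂ ∧ f₃ t = z₃) := by
  have hnw : ∀ {w : ℂ}, ‖w‖ < 1 → ‖-w‖ < 1 := fun h => by simpa using h
  by_cases hx0 : mobius (-w₁) z₁ = 0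
  · rw [hx0, norm_zero, norm_le_zero_iff] at h₂₁ h₃₁
    obtain rfl := mobius_neg_eq_zero hw₁ hz₁ hx0
    obtain rfl := mobius_neg_eq_zero hw₂ hz₂ h₂₁
    obtain rfl := mobius_neg_eq_zero hw₃ hz₃ h₃₁
    have hconst : ∀ {w : ℂ}, ‖w‖ < 1 → (fun _ => w) ∈ holMaps unitDisc unitDisc := fun h =>
      ⟨differentiableOn_const _, fun _ _ => mem_unitDisc.mpr h⟩
    exact ⟨0, fun _ => z₁, fun _ => z₂, fun _ => z₃, zero_mem_unitDisc, by simp [hx0], hconst hw₁,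
      hconst hw₂, hconst hw₃, fun _ _ => hw, ⟨rfl, rfl, rfl⟩, ⟨rfl, rfl, rfl⟩⟩
  obtain ⟨σ, τ, hσ, hτ, hστ⟩ := exists_unimodular_of_triangle ha hb hc h1 h2 h3
  have hσ' := norm_mobius_of_norm_eq_one (hnw hw₁) hσ
  have hτ' := norm_mobius_of_norm_eq_one (hnw hw₂) hτ
  have hx₁ := norm_mobius_lt_one (hnw hw₁) hz₁
  have hx₂ := norm_mobius_lt_one (hnw hw₂) hz₂
  have hx₃ := norm_mobius_lt_one (hnw hw₃) hz₃
  have hz₁' := mobius_mobius_neg hw₁ hz₁.le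
  have hz₂' := mobius_mobius_neg hw₂ hz₂.le
  have hz₃' := mobius_mobius_neg hw₃ hz₃.le
  have hC := surf_mobius_coeff a b c (one_add_conj_mul_ne_zero hw₁ hσ'.le)
    (one_add_conj_mul_ne_zero hw₂ hτ'.le) hw
  rw [mobius_mobius_neg hw₁ hσ.le, mobius_mobius_neg hw₂ hτ.le] at hC
  have hστ' : (c : ℂ) * σ * τ = a * σ + b * τ := by
    have e1 : σ * conj σ = 1 := by rw [Complex.mul_conj']; simp [hσ]
    have e2 : τ * conj τ = 1 := by rw [Complex.mul_conj']; simp [hτ]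
    have e3 := congrArg conj hστ
    simp only [map_add, map_mul, Complex.conj_ofReal] at e3
    linear_combination σ * τ * e3 + a * σ * e2 + b * τ * e1
  have hE := surf_mobius a b c (one_add_conj_mul_ne_zero hw₁ hx₁.le)
    (one_add_conj_mul_ne_zero hw₂ hx₂.le) (one_add_conj_mul_ne_zero hw₃ hx₃.le) hw
  rw [hz₁', hz₂', hz₃', hz, mul_zero] at hE
  have hN := surf_mobius_coeff a b c (one_add_conj_mul_ne_zero hw₁ hx₁.le)
    (one_add_conj_mul_ne_zero hw₂ hx₂.le) hw
  rw [hz₁', hz₂'] at hN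
  have hne : surfCoeff c a b w₃ w₁ w₂ - conj (surfCoeff a b c w₁ w₂ w₃) * mobius (-w₂) z₂ -
      conj (surfCoeff b a c w₂ w₁ w₃) * mobius (-w₁) z₁ ≠ 0 := by
    rw [← hN]
    refine mul_ne_zero (mul_ne_zero (one_add_conj_mul_ne_zero hw₁ hx₁.le)
      (one_add_conj_mul_ne_zero hw₂ hx₂.le)) ?_
    have e : (c - a * z₂ - b * z₁) + conj w₃ * (a * z₁ + b * z₂ - c * z₁ * z₂) =
        (c - a * z₂ - b * z₁) * (1 + conj (-w₃) * z₃) := by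
      unfold surf at hz
      simp only [map_neg]
      linear_combination conj w₃ * hz
    rw [e]
    exact mul_ne_zero (sub_sub_ne_zero_of_surf ha hb hc (by rw [abs_le]; constructor <;> linarith)
      hz₁ hz₂ hz) (one_add_conj_mul_ne_zero (hnw hw₃) hz₃.le)
  obtain ⟨g₂, g₃, hg₂, hg₃, hg₂1, hg₃1, e₂, e₃, hg⟩ :=
    exists_schur_pair (A := surfCoeff a b c w₁ w₂ w₃) (B := surfCoeff b a c w₂ w₁ w₃) hσ' hτ'
      (by linear_combination -hC +
            (1 + conj w₁ * mobius (-w₁) σ) * (1 + conj w₂ * mobius (-w₂) τ) *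
              (hστ - conj w₃ * hστ'))
      (by linear_combination -hE) hx0 hx₁ h₂₁ h₃₁ hne
  have hlt : ∀ g : ℂ → ℂ, (∀ x ∈ unitDisc, ‖g x‖ ≤ 1) → ∀ x ∈ unitDisc, ‖x * g x‖ < 1 := by
    intro g hg x hx
    rw [norm_mul]
    exact (mul_le_of_le_one_right (norm_nonneg _) (hg x hx)).trans_lt (mem_unitDisc.mp hx)
  have hmem : ∀ w : ℂ, ‖w‖ < 1 → ∀ g : ℂ → ℂ, DifferentiableOn ℂ g unitDisc →
      (∀ x ∈ unitDisc, ‖g x‖ ≤ 1) →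
      (fun x => mobius w (x * g x)) ∈ holMaps unitDisc unitDisc := by
    intro w hw g hg hg1
    exact ⟨differentiableOn_mobius_comp hw (differentiableOn_id.mul hg) (hlt g hg1),
      fun x hx => mem_unitDisc.mpr (norm_mobius_lt_one hw (hlt g hg1 x hx))⟩
  refine ⟨mobius (-w₁) z₁, fun x => mobius w₁ (x * 1), fun x => mobius w₂ (x * g₂ x),
    fun x => mobius w₃ (x * g₃ x), mem_unitDisc.mpr hx₁, rfl,
    hmem w₁ hw₁ _ (differentiableOn_const _) (by simp), hmem w₂ hw₂ _ hg₂ hg₂1,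
    hmem w₃ hw₃ _ hg₃ hg₃1, ?_, by simp [mobius_zero], ?_⟩
  · intro x hx
    have n₁ := one_add_conj_mul_ne_zero hw₁ (hlt (fun _ => 1) (by simp) x hx).le
    have n₂ := one_add_conj_mul_ne_zero hw₂ (hlt g₂ hg₂1 x hx).le
    have n₃ := one_add_conj_mul_ne_zero hw₃ (hlt g₃ hg₃1 x hx).le
    have hS := surf_mobius a b c n₁ n₂ n₃ hw
    refine (mul_eq_zero_iff_left (mul_ne_zero (mul_ne_zero n₁ n₂) n₃)).mp ?_
    rw [hS]
    linear_combination x * hg x hx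
  · simp only [mul_one, e₂, e₃]
    exact ⟨hz₁', hz₂', hz₃'⟩

/-! ### The domain as a graph over the surface -/

theorem mem_domainD {a b : ℝ} {z : ℂ × ℂ} :
    z ∈ domainD a b ↔ ‖z.1‖ < 1 ∧ ‖z.2‖ < 1 ∧ denF a b z ≠ 0 ∧ ‖ratF a b z‖ < 1 := by
  simp only [domainD, mem_ofPred_eq, mem_unitDisc]

theorem surf_ratF {a b : ℝ} {z : ℂ × ℂ} (hz : denF a b z ≠ 0) :
    surf a b 1 z.1 z.2 (ratF a b z) = 0 := by
  have h : ratF a b z * denF a b z = numF a b z := div_mul_cancel₀ _ hz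
  unfold surf
  unfold numF at h
  simp only [denF, Complex.ofReal_one] at h ⊢
  linear_combination -h

theorem mem_domainD_of_surf {a b : ℝ} (ha : 0 < a) (hb : 0 < b) (hab : |a - b| ≤ 1)
    {z₁ z₂ z₃ : ℂ} (h₁ : ‖z₁‖ < 1) (h₂ : ‖z₂‖ < 1) (h₃ : ‖z₃‖ < 1)
    (hz : surf a b 1 z₁ z₂ z₃ = 0) : (z₁, z₂) ∈ domainD a b := by
  have h := sub_sub_ne_zero_of_surf ha hb one_pos hab h₁ h₂ hz
  have hd : denF a b (z₁, z₂) ≠ 0 := by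
    intro h0
    unfold denF at h0
    apply h
    push_cast
    linear_combination -h0
  refine mem_domainD.mpr ⟨h₁, h₂, hd, ?_⟩
  have : ratF a b (z₁, z₂) = z₃ := by
    rw [ratF, div_eq_iff hd]
    unfold surf at hz
    simp only [numF, denF, Complex.ofReal_one] at hz ⊢
    linear_combination hz
  rwa [this]

theorem differentiable_numF (a b : ℝ) : Differentiable ℂ (numF a b) := by
  unfold numF
  fun_prop

theorem differentiable_denF (a b : ℝ) : Differentiable ℂ (denF a b) := by
  unfold denF
  fun_prop

theorem ratF_mem_holMaps (a b : ℝ) : ratF a b ∈ holMaps (domainD a b) unitDisc := by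
  refine ⟨?_, fun _ hz => mem_unitDisc.mpr (mem_domainD.mp hz).2.2.2⟩
  unfold ratF
  simp only [div_eq_mul_inv]
  exact (differentiable_numF a b).differentiableOn.mul
    ((differentiable_denF a b).differentiableOn.inv fun _ hz => (mem_domainD.mp hz).2.2.1)

theorem fst_mem_holMaps (a b : ℝ) : Prod.fst ∈ holMaps (domainD a b) unitDisc :=
  ⟨differentiableOn_fst, fun _ hz => hz.1⟩

theorem snd_mem_holMaps (a b : ℝ) : Prod.snd ∈ holMaps (domainD a b) unitDisc :=
  ⟨differentiableOn_snd, fun _ hz => hz.2.1⟩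

theorem isOpen_domainD (a b : ℝ) : IsOpen (domainD a b) := by
  have h : domainD a b = {z : ℂ × ℂ | ‖z.1‖ < 1} ∩ ({z | ‖z.2‖ < 1} ∩
      {z | ‖numF a b z‖ < ‖denF a b z‖}) := by
    ext z
    rw [mem_domainD]
    simp only [mem_inter_iff, mem_ofPred_eq, ratF, norm_div]
    refine and_congr_right fun _ => and_congr_right fun _ => ⟨fun h => ?_, fun h => ?_⟩
    · rw [div_lt_one (norm_pos_iff.mpr h.1)] at h
      exact h.2
    · have h0 : 0 < ‖denF a b z‖ := (norm_nonneg _).trans_lt h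
      exact ⟨norm_pos_iff.mp h0, (div_lt_one h0).mpr h⟩
  rw [h]
  have hn := (differentiable_numF a b).continuous
  have hd := (differentiable_denF a b).continuous
  exact (isOpen_lt (by fun_prop) (by fun_prop)).inter
    ((isOpen_lt (by fun_prop) (by fun_prop)).inter (isOpen_lt (by fun_prop) (by fun_prop)))

theorem norm_sq_denF_sub_norm_sq_numF (a b : ℝ) (z : ℂ × ℂ) :
    ‖denF a b z‖ ^ 2 - ‖numF a b z‖ ^ 2 = 1 - ‖z.1‖ ^ 2 * ‖z.2‖ ^ 2 -
      (a ^ 2 - b ^ 2) * (‖z.1‖ ^ 2 - ‖z.2‖ ^ 2) - 2 * a * z.2.re * (1 - ‖z.1‖ ^ 2) -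
      2 * b * z.1.re * (1 - ‖z.2‖ ^ 2) := by
  simp only [← Complex.normSq_eq_norm_sq, Complex.normSq_apply, denF, numF]
  simp
  ring

/-- For `a + b ≤ 1` the condition `|F| < 1` is void, and the domain is the whole bidisc. -/
theorem mem_domainD_of_add_le_one {a b : ℝ} (ha : 0 < a) (hb : 0 < b) (hab : a + b ≤ 1)
    {z : ℂ × ℂ} (h₁ : ‖z.1‖ < 1) (h₂ : ‖z.2‖ < 1) : z ∈ domainD a b := by
  have key : 0 < ‖denF a b z‖ ^ 2 - ‖numF a b z‖ ^ 2 := by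
    rw [norm_sq_denF_sub_norm_sq_numF]
    have hx := Complex.re_le_norm z.1
    have hy := Complex.re_le_norm z.2
    have hu := norm_nonneg z.1
    have hv := norm_nonneg z.2
    generalize ‖z.1‖ = u at *
    generalize ‖z.2‖ = v at *
    have hu1 : 0 < 1 - u ^ 2 := by nlinarith
    have hv1 : 0 < 1 - v ^ 2 := by nlinarith
    have e1 : a * (1 - u ^ 2) * z.2.re ≤ a * (1 - u ^ 2) * v :=
      mul_le_mul_of_nonneg_left hy (by positivity)
    have e2 : b * (1 - v ^ 2) * z.1.re ≤ b * (1 - v ^ 2) * u :=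
      mul_le_mul_of_nonneg_left hx (by positivity)
    -- Both `((1 - a) ^ 2 - b ^ 2) / 2` and `((1 - b) ^ 2 - a ^ 2) / 2` are nonnegative; they
    -- compare the difference with its value for `a + b = 1`.
    have e3 : 0 ≤ (1 - u ^ 2) * (1 + v ^ 2) * ((1 - a - b) * (1 - a + b)) :=
      mul_nonneg (by positivity) (mul_nonneg (by linarith) (by linarith))
    have e4 : 0 ≤ (1 - v ^ 2) * (1 + u ^ 2) * ((1 - b - a) * (1 - b + a)) :=
      mul_nonneg (by positivity) (mul_nonneg (by linarith) (by linarith))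
    have e5 : 0 < a * (1 - u ^ 2) * (1 - v) ^ 2 := by
      have : 0 < 1 - v := by linarith
      positivity
    have e6 : 0 < b * (1 - v ^ 2) * (1 - u) ^ 2 := by
      have : 0 < 1 - u := by linarith
      positivity
    linear_combination 2 * e1 + 2 * e2 + e3 / 2 + e4 / 2 + e5 + e6
  have hlt : ‖numF a b z‖ < ‖denF a b z‖ :=
    lt_of_pow_lt_pow_left₀ 2 (norm_nonneg _) (by linarith)
  have h0 : 0 < ‖denF a b z‖ := (norm_nonneg _).trans_lt hlt
  refine mem_domainD.mpr ⟨h₁, h₂, norm_pos_iff.mp h0, ?_⟩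
  rwa [ratF, norm_div, div_lt_one h0]

/-- A geodesic disc in the bidisc for two points whose first coordinates are at least as far apart
as the second ones. -/
theorem exists_disc_bidisc {w₁ w₂ z₁ z₂ : ℂ} (hw₁ : ‖w₁‖ < 1) (hw₂ : ‖w₂‖ < 1) (hz₁ : ‖z₁‖ < 1)
    (hz₂ : ‖z₂‖ < 1) (h : ‖mobius (-w₂) z₂‖ ≤ ‖mobius (-w₁) z₁‖) :
    ∃ (t : ℂ) (f₁ f₂ : ℂ → ℂ), t ∈ unitDisc ∧ ‖mobius (-w₁) z₁‖ = ‖t‖ ∧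
      f₁ ∈ holMaps unitDisc unitDisc ∧ f₂ ∈ holMaps unitDisc unitDisc ∧
      (f₁ 0 = w₁ ∧ f₂ 0 = w₂) ∧ (f₁ t = z₁ ∧ f₂ t = z₂) := by
  have hmem : ∀ w η : ℂ, ‖w‖ < 1 → ‖η‖ ≤ 1 →
      (fun x => mobius w (x * η)) ∈ holMaps unitDisc unitDisc := by
    intro w η hw hη
    have hlt : ∀ x ∈ unitDisc, ‖x * η‖ < 1 := by
      intro x hx
      rw [norm_mul]
      exact (mul_le_of_le_one_right (norm_nonneg _) hη).trans_lt (mem_unitDisc.mp hx)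
    exact ⟨differentiableOn_mobius_comp hw (differentiableOn_id.mul_const η) hlt,
      fun x hx => mem_unitDisc.mpr (norm_mobius_lt_one hw (hlt x hx))⟩
  obtain ⟨η, hη, hη'⟩ : ∃ η : ℂ, ‖η‖ ≤ 1 ∧ mobius (-w₁) z₁ * η = mobius (-w₂) z₂ := by
    by_cases h0 : mobius (-w₁) z₁ = 0
    · refine ⟨0, by simp, ?_⟩
      rw [h0, norm_zero, norm_le_zero_iff] at h
      rw [h, mul_zero]
    · refine ⟨mobius (-w₂) z₂ / mobius (-w₁) z₁, ?_, mul_div_cancel₀ _ h0⟩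
      rw [norm_div]
      exact div_le_one_of_le₀ h (norm_nonneg _)
  refine ⟨mobius (-w₁) z₁, fun x => mobius w₁ (x * 1), fun x => mobius w₂ (x * η),
    mem_unitDisc.mpr (norm_mobius_lt_one (by simpa using hw₁) hz₁), rfl,
    hmem _ _ hw₁ (by simp), hmem _ _ hw₂ hη, by simp [mobius_zero], ?_⟩
  simp only [mul_one, hη']
  exact ⟨mobius_mobius_neg hw₁ hz₁.le, mobius_mobius_neg hw₂ hz₂.le⟩

theorem prodMk_mem_holMaps {D : Set (ℂ × ℂ)} {f₁ f₂ : ℂ → ℂ} (h₁ : f₁ ∈ holMaps unitDisc unitDisc)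
    (h₂ : f₂ ∈ holMaps unitDisc unitDisc) (h : ∀ x ∈ unitDisc, (f₁ x, f₂ x) ∈ D) :
    (fun x => (f₁ x, f₂ x)) ∈ holMaps unitDisc D :=
  ⟨h₁.1.prodMk h₂.1, h⟩

/-- Any two points of `domainD a b` lie on a holomorphic disc that is an isometry for one of the
three functions `z.1`, `z.2`, `F z`. -/
theorem exists_geodesic_domainD {a b : ℝ} (ha : 0 < a) (hb : 0 < b) (hab : |a - b| ≤ 1)
    {w z : ℂ × ℂ} (hw : w ∈ domainD a b) (hz : z ∈ domainD a b) :
    ∃ t ∈ unitDisc, ∃ f ∈ holMaps unitDisc (domainD a b), f 0 = w ∧ f t = z ∧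
      ∃ F ∈ holMaps (domainD a b) unitDisc, ‖mobius (-F w) (F z)‖ = ‖t‖ := by
  obtain ⟨hw₁, hw₂, hwd, hw₃⟩ := mem_domainD.mp hw
  obtain ⟨hz₁, hz₂, hzd, hz₃⟩ := mem_domainD.mp hz
  rcases le_total (a + b) 1 with hle | hge
  · rcases le_total ‖mobius (-w.2) z.2‖ ‖mobius (-w.1) z.1‖ with h | h
    · obtain ⟨t, f₁, f₂, ht, hnt, hf₁, hf₂, ⟨e₁, e₂⟩, e₁', e₂'⟩ :=
        exists_disc_bidisc hw₁ hw₂ hz₁ hz₂ h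
      exact ⟨t, ht, fun x => (f₁ x, f₂ x), prodMk_mem_holMaps hf₁ hf₂ fun x hx =>
        mem_domainD_of_add_le_one ha hb hle (mem_unitDisc.mp (hf₁.2 hx))
          (mem_unitDisc.mp (hf₂.2 hx)), Prod.ext e₁ e₂, Prod.ext e₁' e₂', Prod.fst,
        fst_mem_holMaps a b, hnt⟩
    · obtain ⟨t, f₂, f₁, ht, hnt, hf₂, hf₁, ⟨e₂, e₁⟩, e₂', e₁'⟩ :=
        exists_disc_bidisc hw₂ hw₁ hz₂ hz₁ h
      exact ⟨t, ht, fun x => (f₁ x, f₂ x), prodMk_mem_holMaps hf₁ hf₂ fun x hx =>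
        mem_domainD_of_add_le_one ha hb hle (mem_unitDisc.mp (hf₁.2 hx))
          (mem_unitDisc.mp (hf₂.2 hx)), Prod.ext e₁ e₂, Prod.ext e₁' e₂', Prod.snd,
        snd_mem_holMaps a b, hnt⟩
  · have hab' := abs_le.mp hab
    have sw := surf_ratF hwd
    have sz := surf_ratF hzd
    have main : ∀ {f₁ f₂ f₃ : ℂ → ℂ}, f₁ ∈ holMaps unitDisc unitDisc →
        f₂ ∈ holMaps unitDisc unitDisc → f₃ ∈ holMaps unitDisc unitDisc →
        (∀ x ∈ unitDisc, surf a b 1 (f₁ x) (f₂ x) (f₃ x) = 0) →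
        (fun x => (f₁ x, f₂ x)) ∈ holMaps unitDisc (domainD a b) :=
      fun hf₁ hf₂ hf₃ hf => prodMk_mem_holMaps hf₁ hf₂ fun x hx =>
        mem_domainD_of_surf ha hb hab (mem_unitDisc.mp (hf₁.2 hx))
          (mem_unitDisc.mp (hf₂.2 hx)) (mem_unitDisc.mp (hf₃.2 hx)) (hf x hx)
    have swap₁₂ : ∀ z₁ z₂ z₃, surf b a 1 z₂ z₁ z₃ = surf a b 1 z₁ z₂ z₃ := by
      intro z₁ z₂ z₃
      unfold surf
      ring
    have rotate : ∀ z₁ z₂ z₃, surf 1 a b z₃ z₁ z₂ = surf a b 1 z₁ z₂ z₃ := by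
      intro z₁ z₂ z₃
      unfold surf
      ring
    by_cases h₂₁ : ‖mobius (-w.2) z.2‖ ≤ ‖mobius (-w.1) z.1‖ ∧
        ‖mobius (-ratF a b w) (ratF a b z)‖ ≤ ‖mobius (-w.1) z.1‖
    · obtain ⟨t, f₁, f₂, f₃, ht, hnt, hf₁, hf₂, hf₃, hf, ⟨e₁, e₂, -⟩, e₁', e₂', -⟩ :=
        exists_disc_of_surf ha hb one_pos (by linarith) (by linarith) (by linarith) hw₁ hw₂ hw₃
          hz₁ hz₂ hz₃ sw sz h₂₁.1 h₂₁.2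
      exact ⟨t, ht, _, main hf₁ hf₂ hf₃ hf, Prod.ext e₁ e₂, Prod.ext e₁' e₂', Prod.fst,
        fst_mem_holMaps a b, hnt⟩
    by_cases h₁₂ : ‖mobius (-w.1) z.1‖ ≤ ‖mobius (-w.2) z.2‖ ∧
        ‖mobius (-ratF a b w) (ratF a b z)‖ ≤ ‖mobius (-w.2) z.2‖
    · obtain ⟨t, f₂, f₁, f₃, ht, hnt, hf₂, hf₁, hf₃, hf, ⟨e₂, e₁, -⟩, e₂', e₁', -⟩ :=
        exists_disc_of_surf hb ha one_pos (by linarith) (by linarith) (by linarith) hw₂ hw₁ hw₃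
          hz₂ hz₁ hz₃ ((swap₁₂ _ _ _).trans sw) ((swap₁₂ _ _ _).trans sz) h₁₂.1 h₁₂.2
      exact ⟨t, ht, _, main hf₁ hf₂ hf₃ fun x hx => (swap₁₂ _ _ _).symm.trans (hf x hx),
        Prod.ext e₁ e₂, Prod.ext e₁' e₂', Prod.snd, snd_mem_holMaps a b, hnt⟩
    · have h₃ : ‖mobius (-w.1) z.1‖ ≤ ‖mobius (-ratF a b w) (ratF a b z)‖ ∧
          ‖mobius (-w.2) z.2‖ ≤ ‖mobius (-ratF a b w) (ratF a b z)‖ := by grind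
      obtain ⟨t, f₃, f₁, f₂, ht, hnt, hf₃, hf₁, hf₂, hf, ⟨-, e₁, e₂⟩, -, e₁', e₂'⟩ :=
        exists_disc_of_surf one_pos ha hb (by linarith) (by linarith) (by linarith) hw₃ hw₁ hw₂
          hz₃ hz₁ hz₂ ((rotate _ _ _).trans sw) ((rotate _ _ _).trans sz) h₃.1 h₃.2
      exact ⟨t, ht, _, main hf₁ hf₂ hf₃ fun x hx => (rotate _ _ _).symm.trans (hf x hx),
        Prod.ext e₁ e₂, Prod.ext e₁' e₂', ratF a b, ratF_mem_holMaps a b, hnt⟩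

theorem isConnected_domainD {a b : ℝ} (ha : 0 < a) (hb : 0 < b) (hab : |a - b| ≤ 1) :
    IsConnected (domainD a b) := by
  refine ⟨⟨0, mem_domainD.mpr (by simp [denF, numF, ratF])⟩, ?_⟩
  refine isPreconnected_of_forall_pair fun w hw z hz => ?_
  obtain ⟨t, ht, f, hf, rfl, rfl, -⟩ := exists_geodesic_domainD ha hb hab hw hz
  exact ⟨f '' unitDisc, hf.2.image_subset, mem_image_of_mem f zero_mem_unitDisc,
    mem_image_of_mem f ht, isPreconnected_unitDisc.image f hf.1.continuousOn⟩

/-! ### Montel's theorem and tautness -/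

/-- Uniformly bounded holomorphic maps satisfy a local Lipschitz bound with a common constant. -/
theorem dist_le_of_norm_le_one {E : Type*} [NormedAddCommGroup E] [NormedSpace ℂ E] {u : ℂ → E}
    (hu : DifferentiableOn ℂ u unitDisc) (hu1 : ∀ x ∈ unitDisc, ‖u x‖ ≤ 1) {x y : ℂ}
    (hx : x ∈ unitDisc) (hy : dist y x < 1 - ‖x‖) :
    dist (u y) (u x) ≤ 2 / (1 - ‖x‖) * dist y x := by
  have hsub : Metric.ball x (1 - ‖x‖) ⊆ unitDisc := by
    intro y hy
    rw [Metric.mem_ball, dist_eq_norm] at hy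
    rw [mem_unitDisc]
    calc ‖y‖ = ‖(y - x) + x‖ := by rw [sub_add_cancel]
      _ ≤ ‖y - x‖ + ‖x‖ := norm_add_le _ _
      _ < 1 := by linarith
  refine Complex.dist_le_div_mul_dist_of_mapsTo_ball (hu.mono hsub) ?_ (Metric.mem_ball.mpr hy)
  intro y hy
  rw [Metric.mem_closedBall, dist_eq_norm]
  linarith [norm_sub_le (u y) (u x), hu1 y (hsub hy), hu1 x hx]

/-- **Montel's theorem** for uniformly bounded sequences of holomorphic maps from the unit disc to
a finite-dimensional space. -/
theorem exists_subseq_tendstoLocallyUniformlyOn {E : Type*} [NormedAddCommGroup E]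
    [NormedSpace ℂ E] [ProperSpace E] {u : ℕ → ℂ → E}
    (hu : ∀ k, DifferentiableOn ℂ (u k) unitDisc) (hu1 : ∀ k, ∀ x ∈ unitDisc, ‖u k x‖ ≤ 1) :
    ∃ φ : ℕ → ℕ, StrictMono φ ∧ ∃ g : ℂ → E, DifferentiableOn ℂ g unitDisc ∧
      TendstoLocallyUniformlyOn (fun k => u (φ k)) g atTop unitDisc := by
  have hlc : LocallyCompactSpace unitDisc := isOpen_unitDisc.locallyCompactSpace
  let P : (unitDisc → E) → Prop := fun F => (∀ x, F x ∈ Metric.closedBall (0 : E) 1) ∧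
    ∀ x y : unitDisc, dist (y : ℂ) x < 1 - ‖(x : ℂ)‖ →
      dist (F y) (F x) ≤ 2 / (1 - ‖(x : ℂ)‖) * dist (y : ℂ) x
  have hcont : ∀ x₀ : unitDisc, ∀ ε > 0, ∃ δ > 0, ∀ x : unitDisc, dist x x₀ < δ →
      ∀ F, P F → dist (F x₀) (F x) < ε := by
    intro x₀ ε hε
    have hpos : 0 < 1 - ‖(x₀ : ℂ)‖ := by linarith [mem_unitDisc.mp x₀.2]
    refine ⟨min (1 - ‖(x₀ : ℂ)‖) (ε * (1 - ‖(x₀ : ℂ)‖) / 2), by positivity, ?_⟩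
    intro x hx F hF
    rw [lt_min_iff] at hx
    have h1 := hF.2 x₀ x hx.1
    rw [dist_comm]
    refine h1.trans_lt ?_
    have h2 : dist (x : ℂ) x₀ < ε * (1 - ‖(x₀ : ℂ)‖) / 2 := hx.2
    rw [div_mul_eq_mul_div, div_lt_iff₀ hpos]
    linarith
  let S : Set C(unitDisc, E) := {F | P F}
  have himage : ContinuousMap.toFun '' S = {F | P F} := by
    ext F
    refine ⟨?_, fun hF => ⟨⟨F, ?_⟩, hF, rfl⟩⟩
    · rintro ⟨G, hG, rfl⟩
      exact hG
    · rw [Metric.continuous_iff]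
      intro x₀ ε hε
      obtain ⟨δ, hδ, h⟩ := hcont x₀ ε hε
      exact ⟨δ, hδ, fun x hx => by rw [dist_comm]; exact h x hx F hF⟩
  have hcompact : IsCompact {F : unitDisc → E | P F} := by
    have hsplit : {F : unitDisc → E | P F} =
        (Set.univ.pi fun _ => Metric.closedBall (0 : E) 1) ∩
        ⋂ (x : unitDisc) (y : unitDisc) (_ : dist (y : ℂ) x < 1 - ‖(x : ℂ)‖),
          {F | dist (F y) (F x) ≤ 2 / (1 - ‖(x : ℂ)‖) * dist (y : ℂ) x} := by
      ext F
      simp [P]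
    rw [hsplit]
    refine (isCompact_univ_pi fun _ => isCompact_closedBall _ _).inter_right ?_
    exact isClosed_iInter fun x => isClosed_iInter fun y => isClosed_iInter fun _ =>
      isClosed_le (by fun_prop) continuous_const
  have hS : IsCompact S := by
    refine ArzelaAscoli.isCompact_of_equicontinuous S (himage ▸ hcompact) ?_
    intro x₀
    rw [Metric.equicontinuousAt_iff]
    intro ε hε
    obtain ⟨δ, hδ, h⟩ := hcont x₀ ε hε
    exact ⟨δ, hδ, fun x hx F => h x hx _ F.2⟩
  have hmem : ∀ k, ∃ F ∈ S, ∀ x : unitDisc, F x = u k x := by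
    intro k
    have hP : P fun x => u k x := ⟨fun x => by simpa using hu1 k x x.2,
      fun x y hxy => dist_le_of_norm_le_one (hu k) (hu1 k) x.2 hxy⟩
    have : (fun x : unitDisc => u k x) ∈ ContinuousMap.toFun '' S := by
      rw [himage]
      exact hP
    obtain ⟨F, hF, hFu⟩ := this
    exact ⟨F, hF, fun x => congrFun hFu x⟩
  choose F hFS hFu using hmem
  obtain ⟨G, -, φ, hφ, hG⟩ := hS.tendsto_subseq hFS
  rw [ContinuousMap.tendsto_iff_tendstoLocallyUniformly] at hG
  obtain ⟨g, hg⟩ : ∃ g : ℂ → E, ∀ x : unitDisc, g x = G x := by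
    classical
    exact ⟨fun x => if h : x ∈ unitDisc then G ⟨x, h⟩ else 0, fun x => by simp [x.2]⟩
  have hlim : TendstoLocallyUniformlyOn (fun k => u (φ k)) g atTop unitDisc := by
    rw [tendstoLocallyUniformlyOn_iff_tendstoLocallyUniformly_comp_coe]
    have e1 : g ∘ ((↑) : unitDisc → ℂ) = G := funext hg
    rw [e1]
    simpa only [Function.comp_apply, hFu] using hG
  exact ⟨φ, hφ, g, hlim.differentiableOn (Eventually.of_forall fun k => hu (φ k)) isOpen_unitDisc,
    hlim⟩

/-- If a bounded holomorphic function, evaluated along a sequence of discs, tends to a unimodular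
function, then the sequence diverges compactly. -/
theorem eventually_disjoint_of_norm_tendsto_one {E : Type*} [NormedAddCommGroup E]
    [NormedSpace ℂ E] {D : Set E} {h : E → ℂ} (hh : h ∈ holMaps D unitDisc) {f : ℕ → ℂ → E}
    {g : ℂ → ℂ} (hg : ∀ x ∈ unitDisc, ‖g x‖ = 1)
    (hlim : TendstoLocallyUniformlyOn (fun k x => h (f k x)) g atTop unitDisc)
    {K : Set ℂ} (hK : K ⊆ unitDisc) (hKc : IsCompact K) {L : Set E} (hL : L ⊆ D)
    (hLc : IsCompact L) : ∀ᶠ k in atTop, Disjoint (f k '' K) L := by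
  rcases L.eq_empty_or_nonempty with rfl | hne
  · simp
  obtain ⟨z, hz, hmax⟩ := hLc.exists_isMaxOn hne (hh.1.continuousOn.mono hL).norm
  have hz1 : ‖h z‖ < 1 := mem_unitDisc.mp (hh.2 (hL hz))
  have hunif := (tendstoLocallyUniformlyOn_iff_forall_isCompact isOpen_unitDisc).mp hlim K hK hKc
  rw [Metric.tendstoUniformlyOn_iff] at hunif
  filter_upwards [hunif (1 - ‖h z‖) (by linarith)] with k hk
  rw [Set.disjoint_left]
  rintro _ ⟨x, hx, rfl⟩ hxL
  have h1 := hk x hx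
  have h2 : ‖h (f k x)‖ ≤ ‖h z‖ := hmax hxL
  have h3 := norm_sub_norm_le (g x) (h (f k x))
  rw [dist_eq_norm] at h1
  rw [hg x (hK hx)] at h3
  linarith

/-- The maximum principle for limits of maps to the disc. -/
theorem norm_lt_one_or_norm_eq_one {g : ℂ → ℂ} (hg : DifferentiableOn ℂ g unitDisc)
    (hg1 : ∀ x ∈ unitDisc, ‖g x‖ ≤ 1) :
    (∀ x ∈ unitDisc, ‖g x‖ < 1) ∨ ∀ x ∈ unitDisc, ‖g x‖ = 1 := by
  by_cases h : ∀ x ∈ unitDisc, ‖g x‖ < 1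
  · exact Or.inl h
  · push Not at h
    obtain ⟨c, hc, hc1⟩ := h
    have hc2 : ‖g c‖ = 1 := le_antisymm (hg1 c hc) hc1
    refine Or.inr fun x hx => ?_
    have := Complex.norm_eqOn_of_isPreconnected_of_isMaxOn isPreconnected_unitDisc isOpen_unitDisc
      hg hc (fun y hy => by simpa [hc2] using hg1 y hy) hx
    simpa [hc2] using this

theorem isTaut_domainD {a b : ℝ} (ha : 0 < a) (hb : 0 < b) (hab : |a - b| ≤ 1) :
    IsTaut (domainD a b) := by
  intro f hf
  have hF := ratF_mem_holMaps a b
  have hD : ∀ k, ∀ x ∈ unitDisc, f k x ∈ domainD a b := fun k x hx => (hf k).2 hx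
  -- The third component records `F`, so that the limit stays on the closed surface.
  obtain ⟨φ, hφ, g, hg, hlim⟩ := exists_subseq_tendstoLocallyUniformlyOn
    (u := fun k x => ((f k x).1, (f k x).2, ratF a b (f k x)))
    (fun k => (hf k).1.fst.prodMk ((hf k).1.snd.prodMk (hF.1.comp (hf k).1 (hf k).2)))
    (fun k x hx => by
      obtain ⟨h1, h2, -, h3⟩ := mem_domainD.mp (hD k x hx)
      simp only [Prod.norm_mk]
      exact max_le h1.le (max_le h2.le h3.le))
  refine ⟨φ, hφ, ?_⟩
  have l₁ : TendstoLocallyUniformlyOn (fun k x => (f (φ k) x).1) (fun x => (g x).1) atTop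
      unitDisc := uniformContinuous_fst.comp_tendstoLocallyUniformlyOn hlim
  have l₂₃ : TendstoLocallyUniformlyOn
      (fun k x => ((f (φ k) x).2, ratF a b (f (φ k) x))) (fun x => (g x).2) atTop unitDisc :=
    uniformContinuous_snd.comp_tendstoLocallyUniformlyOn hlim
  have l₂ : TendstoLocallyUniformlyOn (fun k x => (f (φ k) x).2) (fun x => (g x).2.1) atTop
      unitDisc := uniformContinuous_fst.comp_tendstoLocallyUniformlyOn l₂₃
  have l₃ : TendstoLocallyUniformlyOn (fun k x => ratF a b (f (φ k) x)) (fun x => (g x).2.2) atTop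
      unitDisc := uniformContinuous_snd.comp_tendstoLocallyUniformlyOn l₂₃
  have b₁ : ∀ x ∈ unitDisc, ‖(g x).1‖ ≤ 1 := fun x hx =>
    le_of_tendsto (l₁.tendsto_at hx).norm
      (Eventually.of_forall fun k => (mem_domainD.mp (hD _ x hx)).1.le)
  have b₂ : ∀ x ∈ unitDisc, ‖(g x).2.1‖ ≤ 1 := fun x hx =>
    le_of_tendsto (l₂.tendsto_at hx).norm
      (Eventually.of_forall fun k => (mem_domainD.mp (hD _ x hx)).2.1.le)
  have b₃ : ∀ x ∈ unitDisc, ‖(g x).2.2‖ ≤ 1 := fun x hx =>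
    le_of_tendsto (l₃.tendsto_at hx).norm
      (Eventually.of_forall fun k => (mem_domainD.mp (hD _ x hx)).2.2.2.le)
  rcases norm_lt_one_or_norm_eq_one hg.fst b₁ with c₁ | c₁
  swap
  · exact Or.inr fun K hK hKc L hL hLc =>
      eventually_disjoint_of_norm_tendsto_one (fst_mem_holMaps a b) c₁ l₁ hK hKc hL hLc
  rcases norm_lt_one_or_norm_eq_one hg.snd.fst b₂ with c₂ | c₂
  swap
  · exact Or.inr fun K hK hKc L hL hLc =>
      eventually_disjoint_of_norm_tendsto_one (snd_mem_holMaps a b) c₂ l₂ hK hKc hL hLc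
  rcases norm_lt_one_or_norm_eq_one hg.snd.snd b₃ with c₃ | c₃
  swap
  · exact Or.inr fun K hK hKc L hL hLc =>
      eventually_disjoint_of_norm_tendsto_one hF c₃ l₃ hK hKc hL hLc
  refine Or.inl ⟨fun x => ((g x).1, (g x).2.1), ⟨hg.fst.prodMk hg.snd.fst, fun x hx => ?_⟩, ?_⟩
  · refine mem_domainD_of_surf ha hb hab (c₁ x hx) (c₂ x hx) (c₃ x hx) ?_
    have hcont : Continuous fun z : ℂ × ℂ × ℂ => surf a b 1 z.1 z.2.1 z.2.2 := by
      unfold surf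
      fun_prop
    refine tendsto_nhds_unique ((hcont.tendsto _).comp (hlim.tendsto_at hx)) ?_
    refine tendsto_const_nhds.congr fun k => ?_
    exact (surf_ratF (mem_domainD.mp (hD (φ k) x hx)).2.2.1).symm
  · have hproj : UniformContinuous fun z : ℂ × ℂ × ℂ => (z.1, z.2.1) :=
      uniformContinuous_fst.prodMk (uniformContinuous_fst.comp uniformContinuous_snd)
    exact hproj.comp_tendstoLocallyUniformlyOn hlim

/-! ### Failure of linear convexity -/

/-- Every complex line through the boundary point `(x, x)` with `x = s - √(s ^ 2 - 1)` and
`s = a + b`, where `F = -1`, meets the domain: the restriction of `F` to the line is not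
constant, hence open. -/
theorem exists_mem_domainD_line {a b x : ℝ} (hx0 : 0 < x) (hx1 : x < 1)
    (hx : 1 + x ^ 2 = 2 * (a + b) * x) {v : ℂ × ℂ} (hv : v ≠ 0) :
    ∃ s : ℂ, ((x : ℂ) + s * v.1, (x : ℂ) + s * v.2) ∈ domainD a b := by
  let γ : ℂ → ℂ × ℂ := fun s => ((x : ℂ) + s * v.1, (x : ℂ) + s * v.2)
  have hγ : Differentiable ℂ γ := by fun_prop
  have hγ0 : γ 0 = ((x : ℂ), (x : ℂ)) := by simp [γ]
  have hxC : 1 + (x : ℂ) ^ 2 = 2 * (a + b) * x := by exact_mod_cast hx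
  have hden : denF a b (γ 0) ≠ 0 := by
    rw [hγ0]
    have : denF a b ((x : ℂ), (x : ℂ)) = (((x ^ 2 - 1) / 2 : ℝ) : ℂ) := by
      unfold denF
      push_cast
      linear_combination -hxC / 2
    rw [this, Complex.ofReal_ne_zero]
    nlinarith
  have hF0 : ratF a b (γ 0) = -1 := by
    rw [ratF, div_eq_iff hden, hγ0]
    unfold numF denF
    linear_combination -hxC
  have hdc : Continuous fun s => denF a b (γ s) :=
    (differentiable_denF a b).continuous.comp hγ.continuous
  have hev : ∀ᶠ s in 𝓝 (0 : ℂ), denF a b (γ s) ≠ 0 := hdc.continuousAt.eventually_ne hden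
  have han : AnalyticAt ℂ (fun s => ratF a b (γ s)) 0 := by
    unfold ratF
    exact (((differentiable_numF a b).comp hγ).analyticAt 0).div
      (((differentiable_denF a b).comp hγ).analyticAt 0) hden
  have h1 : ∀ᶠ s in 𝓝 (0 : ℂ), ‖(γ s).1‖ < 1 := by
    refine (hγ.continuous.fst.norm.continuousAt).eventually_lt continuousAt_const ?_
    simpa [hγ0, abs_of_pos hx0] using hx1
  have h2 : ∀ᶠ s in 𝓝 (0 : ℂ), ‖(γ s).2‖ < 1 := by
    refine (hγ.continuous.snd.norm.continuousAt).eventually_lt continuousAt_const ?_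
    simpa [hγ0, abs_of_pos hx0] using hx1
  rcases han.eventually_constant_or_nhds_le_map_nhds with hconst | hopen
  · exfalso
    simp only [hF0] at hconst
    -- On the line, `numF + denF` is a quadratic polynomial in `s` without constant term.
    have hpoly : ∀ᶠ s in 𝓝 (0 : ℂ), s * ((a + b - x) * (v.1 + v.2) - s * (v.1 * v.2)) = 0 := by
      filter_upwards [hconst, hev] with s hs hs'
      rw [ratF, div_eq_iff hs'] at hs
      simp only [numF, denF, γ] at hs
      linear_combination hs + hxC
    have hpoly' : ∀ᶠ s in 𝓝[≠] (0 : ℂ), (a + b - x) * (v.1 + v.2) - s * (v.1 * v.2) = 0 := by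
      filter_upwards [hpoly.filter_mono nhdsWithin_le_nhds, self_mem_nhdsWithin] with s hs hs0
      exact (mul_eq_zero.mp hs).resolve_left hs0
    have hlim : Tendsto (fun s : ℂ => (a + b - x) * (v.1 + v.2) - s * (v.1 * v.2)) (𝓝[≠] 0)
        (𝓝 ((a + b - x) * (v.1 + v.2) - 0 * (v.1 * v.2))) :=
      (Continuous.tendsto (by fun_prop) 0).mono_left nhdsWithin_le_nhds
    have hlin : (a + b - x : ℂ) * (v.1 + v.2) - 0 * (v.1 * v.2) = 0 :=
      tendsto_nhds_unique hlim (tendsto_const_nhds.congr' (hpoly'.mono fun s hs => hs.symm))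
    obtain ⟨s, hs, hs0⟩ := (hpoly'.and self_mem_nhdsWithin).exists
    have hprod : v.1 * v.2 = 0 := by
      refine (mul_eq_zero.mp ?_).resolve_left hs0
      linear_combination hlin - hs
    have hne : (a + b - x : ℂ) ≠ 0 := by
      have : a + b - x ≠ 0 := by
        intro h
        nlinarith
      exact_mod_cast this
    have hsum : v.1 + v.2 = 0 := by
      refine (mul_eq_zero.mp ?_).resolve_left hne
      linear_combination hlin
    rcases mul_eq_zero.mp hprod with h | h
    · exact hv (Prod.ext h (by simpa [h] using hsum))
    · exact hv (Prod.ext (by simpa [h] using hsum) h)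
  · rw [hF0] at hopen
    have hfreq : ∃ᶠ y in 𝓝 (-1 : ℂ), ‖y‖ < 1 := by
      have : (-1 : ℂ) ∈ closure (Metric.ball (0 : ℂ) 1) := by
        rw [closure_ball _ one_ne_zero]
        simp
      refine (mem_closure_iff_frequently.mp this).mono fun y hy => by simpa using hy
    have hfreq' : ∃ᶠ s in 𝓝 (0 : ℂ), ‖ratF a b (γ s)‖ < 1 := by
      have := hfreq.filter_mono hopen
      rwa [frequently_map] at this
    obtain ⟨s, hs, hs1, hs2, hs3⟩ := (hfreq'.and_eventually (h1.and (h2.and hev))).exists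
    exact ⟨s, mem_domainD.mpr ⟨hs1, hs2, hs3, hs⟩⟩

theorem not_isLinearlyConvex_domainD {a b : ℝ} (hab : 1 < a + b) :
    ¬ IsLinearlyConvex (domainD a b) := by
  intro hlin
  have hs : √((a + b) ^ 2 - 1) ^ 2 = (a + b) ^ 2 - 1 := Real.sq_sqrt (by nlinarith)
  have hs0 : 0 ≤ √((a + b) ^ 2 - 1) := Real.sqrt_nonneg _
  obtain ⟨x, hxdef⟩ : ∃ x, x = a + b - √((a + b) ^ 2 - 1) := ⟨_, rfl⟩
  have hx : 1 + x ^ 2 = 2 * (a + b) * x := by rw [hxdef]; linear_combination hs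
  have hx0 : 0 < x := by nlinarith
  have hx1 : x < 1 := by
    by_contra! h
    nlinarith
  have hxC : 1 + (x : ℂ) ^ 2 = 2 * (a + b) * x := by exact_mod_cast hx
  have hnot : ((x : ℂ), (x : ℂ)) ∉ domainD a b := by
    intro hmem
    obtain ⟨-, -, hd, hF⟩ := mem_domainD.mp hmem
    have : ratF a b ((x : ℂ), (x : ℂ)) = -1 := by
      rw [ratF, div_eq_iff hd]
      unfold numF denF
      linear_combination -hxC
    rw [this] at hF
    simp at hF
  obtain ⟨ℓ, hℓ, hdisj⟩ := hlin _ hnot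
  have hℓv : ∀ u : ℂ × ℂ, ℓ u = u.1 * ℓ (1, 0) + u.2 * ℓ (0, 1) := by
    intro u
    have : u = u.1 • ((1, 0) : ℂ × ℂ) + u.2 • ((0, 1) : ℂ × ℂ) := by ext <;> simp
    conv_lhs => rw [this]
    simp only [map_add, map_smul, smul_eq_mul]
  have hv : ((ℓ (0, 1), -ℓ (1, 0)) : ℂ × ℂ) ≠ 0 := by
    intro h
    obtain ⟨h1, h2⟩ := Prod.ext_iff.mp h
    simp only [Prod.fst_zero, Prod.snd_zero, neg_eq_zero] at h1 h2
    exact hℓ (ContinuousLinearMap.ext fun u => by rw [hℓv, h1, h2]; simp)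
  obtain ⟨s, hs⟩ := exists_mem_domainD_line (a := a) (b := b) hx0 hx1 hx hv
  refine hdisj _ ?_ hs
  rw [hℓv, hℓv ((x : ℂ), (x : ℂ))]
  ring

theorem theorem3p5 (a b : ℝ) (ha : 0 < a) (hb : 0 < b) (hab : |a - b| ≤ 1) :
    IsLempertDomain (domainD a b) ∧
      (TriangleIneq a b 1 → ¬ IsLinearlyConvex (domainD a b)) := by
  refine ⟨⟨isOpen_domainD a b, isConnected_domainD ha hb hab, isTaut_domainD ha hb hab,
    fun w hw z hz => ?_⟩, fun h => not_isLinearlyConvex_domainD h.2.2⟩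
  obtain ⟨t, ht, f, hf, hfw, hfz, F, hF, hFt⟩ := exists_geodesic_domainD ha hb hab hw hz
  exact caratheodoryDist_eq_lempertFunction_of_disc hf ht hfw hfz hF hFt
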